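/- There is an absolute constant $C>0$ such that the following holds. In the problem considered, $E$ is a finite ground set of $n$ elements, $f:2^E\to\mathbb{R}_{\ge 0}$ is monotone and submodular, and $k$ is a cardinality bound. The elements arrive one by one in the adversarial-injections model: an adversary, who chooses $E$ and $f$, partitions $E=E_{\mathrm{good}}\cup E_{\mathrm{noise}}$ and fixes an order of $E$; then the elements of $E_{\mathrm{good}}$ are permuted uniformly at random among the positions they occupy, while the elements of $E_{\mathrm{noise}}$ keep their positions. The algorithm knows $k$, but neither $n$ nor the partition. It keeps a list of elements in memory; when an element arrives, the new memory may contain only elements of the old memory and the arriving element, and the algorithm may query the value $f(S)$ only for sets $S$ of elements that are in memory or have just arrived. At the end it returns a set of elements from its memory. There is a deterministic streaming algorithm of this kind (depending on $k$, but not on $n$, $E$, $f$, the order or the partition) which on every such instance, for every realization of the permutation, has at most $(Ck)^k$ elements in memory after every arrival (a number independent of $n$) and returns a set $S\subseteq E$ with $|S|\le k$, and which satisfies $$\mathbb{E}[f(S)]\;\ge\;0.55\cdot\max\{f(T): T\subseteq E_{\mathrm{good}},\ |T|\le k\},$$ where the expectation is over the uniformly random permutation of $E_{\mathrm{good}}$.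 -/

import Mathlib

open scoped BigOperators

/-- `f` is a nonnegative, monotone and submodular set function on the ground set `E`: only its
values on subsets of `E` matter. (It is not assumed that `f ∅ = 0`.) -/
structure IsMonotoneSubmodularOn {U : Type*} [DecidableEq U]
    (f : Finset U → ℝ) (E : Finset U) : Prop where
  nonneg : ∀ S ⊆ E, 0 ≤ f S
  mono : ∀ S T : Finset U, S ⊆ T → T ⊆ E → f S ≤ f T
  submodular : ∀ S T : Finset U, S ⊆ E → T ⊆ E → f (S ∪ T) + f (S ∩ T) ≤ f S + f T

/-- The value oracle of `f` as seen by an algorithm that has exactly the elements of `A` at hand: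
queries about subsets of `A` are answered correctly, all other queries are answered by `0`. -/
noncomputable def visibleOracle {U : Type*} [DecidableEq U]
    (f : Finset U → ℝ) (A : Finset U) : Finset U → ℝ :=
  fun S => if S ⊆ A then f S else 0

/-- A deterministic streaming algorithm over element identities in `U`.
Its memory is a finite list of elements and nothing else. When an element arrives, the new memory
is computed from a value oracle, the old memory and the arriving element, and it may only hold
elements of the old memory and the arriving element. At the end of the stream the solution is
computed from a value oracle and the memory, and it consists of stored elements. -/
structure StreamingAlgorithm (U : Type*) [DecidableEq U] where
  /-- the new memory from oracle, old memory, and arriving element -/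
  step : (Finset U → ℝ) → List U → U → List U
  step_subset : ∀ q M e, step q M e ⊆ e :: M
  /-- the returned solution from oracle and final memory -/
  output : (Finset U → ℝ) → List U → Finset U
  output_subset : ∀ q M, output q M ⊆ M.toFinset

namespace StreamingAlgorithm

variable {U : Type*} [DecidableEq U]

/-- The memory after reading the list `s`, starting from the empty memory. In every step the oracle
can only be queried about sets of elements that are stored or have just arrived. -/
noncomputable def memory (A : StreamingAlgorithm U) (f : Finset U → ℝ) (s : List U) : List U :=
  s.foldl (fun M e => A.step (visibleOracle f (insert e M.toFinset)) M e) []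

/-- The solution returned after reading the list `s`. -/
noncomputable def solution (A : StreamingAlgorithm U) (f : Finset U → ℝ) (s : List U) : Finset U :=
  A.output (visibleOracle f (A.memory f s).toFinset) (A.memory f s)

end StreamingAlgorithm

/-- The adversarial-injections model: the adversary fixes the order `σ` of the `n` elements and the
set `G` of positions that hold the good elements. The good elements are permuted among these
positions by `π`; the other elements (the noise) stay where they are. -/
def arrivalOrder {U : Type*} {n : ℕ} (σ : Fin n ↪ U) (G : Finset (Fin n))
    (π : Equiv.Perm {i // i ∈ G}) : List U :=
  List.ofFn fun i => σ (Equiv.Perm.ofSubtype π i)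

/-- The largest value of `f` on a subset of `A` with at most `k` elements. -/
noncomputable def optValue {U : Type*} [DecidableEq U]
    (f : Finset U → ℝ) (k : ℕ) (A : Finset U) : ℝ :=
  (A.powerset.filter fun S => S.card ≤ k).sup' ⟨∅, by simp⟩ f

set_option linter.unusedSectionVars false

section RecordTree

variable {U Λ : Type*} [DecidableEq U] [LinearOrder Λ] [OrderBot Λ]

open Classical in
/-- One step of the record tree. The tree is a set of paths, newest element first. The arriving
element `e` extends the path `p` if its class with respect to `p` is at least `J`, is not the bottom
class, and exceeds the classes of all previous extensions of `p`. -/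
noncomputable def recordStep (cls : List U → U → Λ) (k : ℕ) (J : Λ) (T : Finset (List U)) (e : U) :
    Finset (List U) :=
  T ∪ (T.filter fun p => p.length < k ∧ J ≤ cls p e ∧ ⊥ < cls p e ∧
    ∀ c, c :: p ∈ T → cls p c < cls p e).image (List.cons e)

/-- The tree of paths of records in the stream `s`. -/
noncomputable def recordTree (cls : List U → U → Λ) (k : ℕ) (J : Λ) (s : List U) :
    Finset (List U) :=
  s.foldl (recordStep cls k J) {[]}

variable {cls : List U → U → Λ} {k : ℕ} {J : Λ}

@[simp]
theorem recordTree_nil : recordTree cls k J [] = {[]} := rfl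

theorem recordTree_append_singleton (s : List U) (e : U) :
    recordTree cls k J (s ++ [e]) = recordStep cls k J (recordTree cls k J s) e := by
  simp [recordTree]

theorem mem_recordStep {T : Finset (List U)} {e : U} {p : List U} :
    p ∈ recordStep cls k J T e ↔ p ∈ T ∨ ∃ p' ∈ T, (p'.length < k ∧ J ≤ cls p' e ∧ ⊥ < cls p' e ∧
      ∀ c, c :: p' ∈ T → cls p' c < cls p' e) ∧ e :: p' = p := by
  simp only [recordStep, Finset.mem_union, Finset.mem_image, Finset.mem_filter, and_assoc]

theorem recordTree_subset_append (s t : List U) :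
    recordTree cls k J s ⊆ recordTree cls k J (s ++ t) := by
  induction t using List.reverseRecOn with
  | nil => simp
  | append_singleton t e ih =>
    rw [← List.append_assoc, recordTree_append_singleton]
    exact ih.trans Finset.subset_union_left

theorem nil_mem_recordTree (s : List U) : [] ∈ recordTree cls k J s := by
  simpa using recordTree_subset_append (cls := cls) (k := k) (J := J) [] s (by simp)

theorem length_le_of_mem_recordTree {s p : List U} (hp : p ∈ recordTree cls k J s) :
    p.length ≤ k := by
  induction s using List.reverseRecOn generalizing p with
  | nil => simp_all
  | append_singleton s e ih =>
    rw [recordTree_append_singleton, mem_recordStep] at hp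
    obtain hp | ⟨p', hp', ⟨h, -⟩, rfl⟩ := hp
    · exact ih hp
    · simpa using h

theorem subset_of_mem_recordTree {s p : List U} (hp : p ∈ recordTree cls k J s) : p ⊆ s := by
  induction s using List.reverseRecOn generalizing p with
  | nil => simp_all
  | append_singleton s e ih =>
    rw [recordTree_append_singleton, mem_recordStep] at hp
    obtain hp | ⟨p', hp', -, rfl⟩ := hp
    · exact List.Subset.trans (ih hp) (List.subset_append_left _ _)
    · exact List.cons_subset.2 ⟨by simp, List.Subset.trans (ih hp') (List.subset_append_left _ _)⟩

theorem tail_mem_recordTree {s p : List U} {e : U} (hp : e :: p ∈ recordTree cls k J s) :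
    p ∈ recordTree cls k J s ∧ J ≤ cls p e ∧ ⊥ < cls p e := by
  induction s using List.reverseRecOn generalizing p e with
  | nil => simp_all
  | append_singleton s x ih =>
    have hmono := recordTree_subset_append (cls := cls) (k := k) (J := J) s [x]
    rw [recordTree_append_singleton, mem_recordStep] at hp
    obtain hp | ⟨p', hp', ⟨-, h1, h2, -⟩, h⟩ := hp
    · exact ⟨hmono (ih hp).1, (ih hp).2⟩
    · obtain ⟨rfl, rfl⟩ := List.cons.inj h
      exact ⟨hmono hp', h1, h2⟩

theorem eq_of_cls_eq {s p : List U} {c e : U} (hc : c :: p ∈ recordTree cls k J s)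
    (he : e :: p ∈ recordTree cls k J s) (h : cls p c = cls p e) : c = e := by
  induction s using List.reverseRecOn generalizing p c e with
  | nil => simp_all
  | append_singleton s x ih =>
    rw [recordTree_append_singleton, mem_recordStep] at hc he
    obtain hc | ⟨p', hp', ⟨-, -, -, h1⟩, hx⟩ := hc <;>
    obtain he | ⟨p'', hp'', ⟨-, -, -, h2⟩, hx'⟩ := he
    · exact ih hc he h
    · obtain ⟨rfl, rfl⟩ := List.cons.inj hx'
      exact absurd h (h2 _ hc).ne
    · obtain ⟨rfl, rfl⟩ := List.cons.inj hx
      exact absurd h (h1 _ he).ne'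
    · exact (List.cons.inj hx).1.symm.trans (List.cons.inj hx').1

/-- When `o` arrives and its class with respect to a path `p` is relevant, then either an extension
of `p` of at least the same class is present, or `o` becomes one. -/
theorem exists_extension_or {s p : List U} (hp : p ∈ recordTree cls k J s) (hk : p.length < k)
    {o : U} (hJ : J ≤ cls p o) (hbot : ⊥ < cls p o) :
    (∃ c, c :: p ∈ recordTree cls k J s ∧ cls p o ≤ cls p c) ∨
      o :: p ∈ recordTree cls k J (s ++ [o]) := by
  by_cases h : ∃ c, c :: p ∈ recordTree cls k J s ∧ cls p o ≤ cls p c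
  · exact Or.inl h
  · push Not at h
    rw [recordTree_append_singleton, mem_recordStep]
    exact Or.inr (Or.inr ⟨p, hp, ⟨hk, hJ, hbot, h⟩, rfl⟩)

theorem exists_root_extension {s : List U} (hk : 0 < k) {o : U} (ho : o ∈ s)
    (hJ : J ≤ cls [] o) (hbot : ⊥ < cls [] o) :
    ∃ c, [c] ∈ recordTree cls k J s ∧ cls [] o ≤ cls [] c := by
  obtain ⟨s₁, s₂, rfl⟩ := List.append_of_mem ho
  have hsub := recordTree_subset_append (cls := cls) (k := k) (J := J) (s₁ ++ [o]) s₂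
  rw [List.append_assoc, List.singleton_append] at hsub
  obtain ⟨c, hc, h⟩ | h := exists_extension_or (nil_mem_recordTree s₁) hk hJ hbot
  · exact ⟨c, hsub (recordTree_subset_append _ _ hc), h⟩
  · exact ⟨o, hsub h, le_rfl⟩

/-- All classes along the path are at least `J`. -/
def ClassesGE (cls : List U → U → Λ) (J : Λ) : List U → Prop
  | [] => True
  | e :: p => J ≤ cls p e ∧ ClassesGE cls J p

theorem mem_recordTree_of_le {J' : Λ} (hJ : J ≤ J') (s p : List U) :
    p ∈ recordTree cls k J' s ↔ p ∈ recordTree cls k J s ∧ ClassesGE cls J' p := by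
  induction s using List.reverseRecOn generalizing p with
  | nil =>
    simp only [recordTree_nil, Finset.mem_singleton, iff_self_and]
    rintro rfl
    trivial
  | append_singleton s e ih =>
    simp only [recordTree_append_singleton, mem_recordStep, ih]
    constructor
    · rintro (h | ⟨p', ⟨hp', hge⟩, ⟨hk, hJ', hbot, hc⟩, rfl⟩)
      · exact ⟨Or.inl h.1, h.2⟩
      · refine ⟨Or.inr ⟨p', hp', ⟨hk, hJ.trans hJ', hbot, fun c hcT => ?_⟩, rfl⟩, hJ', hge⟩
        by_cases hcJ : J' ≤ cls p' c
        · exact hc c ⟨hcT, hcJ, hge⟩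
        · exact (not_le.1 hcJ).trans_le hJ'
    · rintro ⟨h | ⟨p', hp', ⟨hk, -, hbot, hc⟩, rfl⟩, hge⟩
      · exact Or.inl ⟨h, hge⟩
      · exact Or.inr ⟨p', ⟨hp', hge.2⟩, ⟨hk, hge.1, hbot, fun c hcT => hc c hcT.1⟩, rfl⟩

/-- Elements that lie on no path can be removed from the stream. -/
theorem recordTree_filter (X : U → Bool) (s : List U)
    (h : ∀ p ∈ recordTree cls k J s, ∀ e ∈ p, X e) :
    recordTree cls k J (s.filter X) = recordTree cls k J s := by
  induction s using List.reverseRecOn with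
  | nil => rfl
  | append_singleton s e ih =>
    have ih := ih fun p hp => h p (recordTree_subset_append s [e] hp)
    rw [List.filter_append]
    by_cases he : X e
    · rw [List.filter_singleton, he, cond_true, recordTree_append_singleton,
        recordTree_append_singleton, ih]
    · rw [List.filter_singleton, Bool.eq_false_of_not_eq_true he, cond_false, List.append_nil, ih,
        recordTree_append_singleton]
      refine Finset.Subset.antisymm Finset.subset_union_left fun p hp => ?_
      obtain hp' | ⟨p', -, -, rfl⟩ := mem_recordStep.1 hp
      · exact hp'
      · exact absurd (h _ (by rwa [recordTree_append_singleton]) e (by simp)) he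

theorem recordTree_congr {cls' : List U → U → Λ} (s : List U)
    (h : ∀ p e, p ⊆ s → e ∈ s → cls p e = cls' p e) :
    recordTree cls k J s = recordTree cls' k J s := by
  induction s using List.reverseRecOn with
  | nil => rfl
  | append_singleton s e ih =>
    have ih := ih fun p x hp hx =>
      h p x (List.Subset.trans hp (List.subset_append_left _ _)) (List.mem_append_left _ hx)
    rw [recordTree_append_singleton, recordTree_append_singleton, ← ih]
    have key : ∀ p ∈ recordTree cls k J s, ∀ x ∈ s ++ [e], cls p x = cls' p x := fun p hp x hx =>
      h p x (List.Subset.trans (subset_of_mem_recordTree hp) (List.subset_append_left _ _)) hx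
    ext p
    simp only [mem_recordStep]
    refine or_congr_right (exists_congr fun p' => and_congr_right fun hp' => and_congr_left' ?_)
    rw [key p' hp' e (by simp)]
    refine and_congr_right fun _ => and_congr_right fun _ => and_congr_right fun _ =>
      forall_congr' fun c => imp_congr_right fun hc => ?_
    rw [key p' hp' c (List.mem_append_left _ (subset_of_mem_recordTree hc (by simp)))]

/-- The classes along a path, newest first. -/
def pathClasses (cls : List U → U → Λ) : List U → List Λ
  | [] => []
  | e :: p => cls p e :: pathClasses cls p

@[simp]
theorem length_pathClasses (p : List U) : (pathClasses cls p).length = p.length := by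
  induction p with
  | nil => rfl
  | cons e p ih => simp [pathClasses, ih]

theorem pathClasses_injOn (s : List U) :
    Set.InjOn (pathClasses cls) (recordTree cls k J s : Set (List U)) := by
  intro p hp
  induction p with
  | nil =>
    rintro (_ | ⟨e, q⟩) - h
    · rfl
    · simp [pathClasses] at h
  | cons c p ih =>
    rintro (_ | ⟨e, q⟩) hq h
    · simp [pathClasses] at h
    · simp only [pathClasses, List.cons.injEq] at h
      have := ih (tail_mem_recordTree hp).1 (tail_mem_recordTree hq).1 h.2
      subst this
      rw [eq_of_cls_eq hp hq h.1]

theorem pathClasses_subset {s : List U} {K : Finset Λ}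
    (hK : ∀ p e, e :: p ∈ recordTree cls k J s → cls p e ∈ K) {p : List U}
    (hp : p ∈ recordTree cls k J s) : ∀ l ∈ pathClasses cls p, l ∈ K := by
  induction p with
  | nil => simp [pathClasses]
  | cons e p ih =>
    intro l hl
    rw [pathClasses, List.mem_cons] at hl
    obtain rfl | hl := hl
    · exact hK p e hp
    · exact ih (tail_mem_recordTree hp).1 l hl

/-- There are at most `(N + 1) ^ k` lists of length at most `k` over `N` letters. -/
theorem card_le_of_length_le {K : Finset Λ} {k : ℕ} (S : Finset (List Λ))
    (h : ∀ l ∈ S, l.length ≤ k ∧ ∀ x ∈ l, x ∈ K) : S.card ≤ (K.card + 1) ^ k := by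
  classical
  have hcard : (Fintype.piFinset fun _ : Fin k => Finset.insertNone K).card = (K.card + 1) ^ k := by
    simp
  rw [← hcard]
  refine Finset.card_le_card_of_injOn (fun l i => l[(i : ℕ)]?) (fun l hl => ?_) ?_
  · rw [Finset.mem_coe, Fintype.mem_piFinset]
    intro i
    rw [Finset.mem_insertNone]
    intro x hx
    exact (h l hl).2 x (List.mem_of_getElem? hx)
  · intro l hl l' hl' hll
    refine List.ext_getElem? fun i => ?_
    by_cases hi : i < k
    · exact congrFun hll ⟨i, hi⟩
    · rw [List.getElem?_eq_none ((h l hl).1.trans (not_lt.1 hi)),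
        List.getElem?_eq_none ((h l' hl').1.trans (not_lt.1 hi))]

theorem card_recordTree_le {s : List U} {K : Finset Λ}
    (hK : ∀ p e, e :: p ∈ recordTree cls k J s → cls p e ∈ K) :
    (recordTree cls k J s).card ≤ (K.card + 1) ^ k := by
  classical
  rw [← Finset.card_image_of_injOn (pathClasses_injOn s)]
  refine card_le_of_length_le _ fun l hl => ?_
  obtain ⟨p, hp, rfl⟩ := Finset.mem_image.1 hl
  exact ⟨by simpa using length_le_of_mem_recordTree hp, pathClasses_subset hK hp⟩

/-- The elements on the paths of the record tree, in the order of the stream. -/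
noncomputable def recordElements (cls : List U → U → Λ) (k : ℕ) (J : Λ) (s : List U) : List U :=
  s.filter fun e => ∃ p ∈ recordTree cls k J s, e ∈ p

theorem mem_recordElements {s : List U} {e : U} :
    e ∈ recordElements cls k J s ↔ ∃ p ∈ recordTree cls k J s, e ∈ p := by
  simp only [recordElements, List.mem_filter, decide_eq_true_eq, and_iff_right_iff_imp]
  rintro ⟨p, hp, he⟩
  exact subset_of_mem_recordTree hp he

theorem recordTree_recordElements {J' : Λ} (hJ : J ≤ J') (s : List U) :
    recordTree cls k J' (recordElements cls k J s) = recordTree cls k J' s := by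
  have h : recordTree cls k J (recordElements cls k J s) = recordTree cls k J s :=
    recordTree_filter _ _ fun p hp e he => by simpa using ⟨p, hp, he⟩
  ext p
  rw [mem_recordTree_of_le hJ, mem_recordTree_of_le hJ, h]

theorem recordElements_append {J' : Λ} (hJ : J ≤ J') {s : List U} {e : U} (he : e ∉ s) :
    recordElements cls k J' (recordElements cls k J s ++ [e]) =
      recordElements cls k J' (s ++ [e]) := by
  have h : recordTree cls k J' (recordElements cls k J s ++ [e]) =
      recordTree cls k J' (s ++ [e]) := by
    rw [recordTree_append_singleton, recordTree_append_singleton, recordTree_recordElements hJ]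
  unfold recordElements at h ⊢
  rw [h, List.filter_append, List.filter_append, List.filter_filter]
  congr 1
  refine List.filter_congr fun x hx => ?_
  simp only [Bool.and_eq_decide, decide_eq_decide, decide_eq_true_eq, and_iff_left_iff_imp]
  rintro ⟨p, hp, hxp⟩
  rw [← h] at hp
  have := subset_of_mem_recordTree hp hxp
  rw [List.mem_append, List.mem_singleton] at this
  obtain h | rfl := this
  · exact mem_recordElements.1 h
  · exact absurd hx he

theorem exists_cons_mem_recordTree {s p : List U} {e : U} (hp : p ∈ recordTree cls k J s)
    (he : e ∈ p) : ∃ p', e :: p' ∈ recordTree cls k J s := by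
  induction p with
  | nil => simp at he
  | cons x p ih =>
    obtain rfl | he := List.mem_cons.1 he
    · exact ⟨p, hp⟩
    · exact ih (tail_mem_recordTree hp).1 he

theorem length_recordElements_le {s : List U} (hs : s.Nodup) :
    (recordElements cls k J s).length ≤ (recordTree cls k J s).card := by
  classical
  rw [← List.toFinset_card_of_nodup (show (recordElements cls k J s).Nodup from hs.filter _)]
  refine (Finset.card_le_card fun e he => ?_ :
    _ ≤ ((recordTree cls k J s).biUnion fun p => p.head?.toFinset).card).trans
      (Finset.card_biUnion_le.trans ?_)
  · obtain ⟨p, hp, hep⟩ := mem_recordElements.1 (List.mem_toFinset.1 he)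
    obtain ⟨p', hp'⟩ := exists_cons_mem_recordTree hp hep
    exact Finset.mem_biUnion.2 ⟨_, hp', by simp⟩
  · refine (Finset.sum_le_card_nsmul _ _ 1 fun p _ => ?_).trans (by simp)
    cases p <;> simp

end RecordTree

section Guarantee

/-- The guaranteed fraction of the value of the `r` unseen optimal elements when `b` more elements
can be added to the solution. -/
noncomputable def guarantee (r b : ℕ) : ℝ := 0.86 * (b / r) - 0.3 * (b / r) ^ 2

theorem guarantee_le_one (r b : ℕ) : guarantee r b ≤ 1 := by
  unfold guarantee
  nlinarith [sq_nonneg ((b : ℝ) / r - 43 / 30)]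

theorem guarantee_nonneg {r b : ℕ} (h : b ≤ r) : 0 ≤ guarantee r b := by
  have h0 : (0 : ℝ) ≤ b / r := by positivity
  have h1 : (b : ℝ) / r ≤ 1 := div_le_one_of_le₀ (by exact_mod_cast h) (by positivity)
  unfold guarantee
  nlinarith

theorem guarantee_self {r : ℕ} (h : 0 < r) : guarantee r r = 0.56 := by
  have : (r : ℝ) ≠ 0 := by positivity
  unfold guarantee
  rw [div_self this]
  norm_num

@[simp]
theorem guarantee_zero_right (r : ℕ) : guarantee r 0 = 0 := by
  simp [guarantee]

/-- Abel summation against a decreasing sequence. -/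
theorem le_of_decreasing_weights {N T₁ T₂ T₃ D G₁ G₂ G₃ : ℝ} (hN : 0 ≤ N) (h₁ : N ≤ T₁)
    (h₂ : N ≤ T₂) (h₃ : N ≤ T₃) (hD : D ≤ G₁) (h12 : G₂ ≤ G₁) (h23 : G₃ ≤ G₂) (h3 : 0 ≤ G₃) :
    N * D ≤ T₁ * (G₁ - G₂) + T₂ * (G₂ - G₃) + T₃ * G₃ := by
  nlinarith [mul_le_mul_of_nonneg_left hD hN, mul_nonneg (sub_nonneg.2 h₁) (sub_nonneg.2 h12),
    mul_nonneg (sub_nonneg.2 h₂) (sub_nonneg.2 h23), mul_nonneg (sub_nonneg.2 h₃) h3]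

theorem guarantee_mix_real {s t D G₁ G₂ G₃ V V₁ V₂ p : ℝ} (ht : 1 ≤ t) (hts : t ≤ s)
    (hV : V = 0.86 * ((t + 1) / (s + 1)) - 0.3 * ((t + 1) / (s + 1)) ^ 2)
    (hV₁ : V₁ = 0.86 * (t / s) - 0.3 * (t / s) ^ 2)
    (hV₂ : V₂ = 0.86 * ((t - 1) / s) - 0.3 * ((t - 1) / s) ^ 2) (hp : p = t / (s + 1))
    (hD : D ≤ G₁) (h12 : G₂ ≤ G₁) (h23 : G₃ ≤ G₂) (h3 : 0 ≤ G₃) :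
    (s + 1) * (V * D) ≤
      (1 - p) * ((s + 1) * (V₁ * D) + (0.99 * (1 - V₁) * G₁ - V₁ * G₂)) +
        p * ((s + 1) * (V₂ * D) + (0.99 * (1 - V₂) * (G₁ + G₂) - V₂ * G₃)) := by
  have hs : 0 < s := by linarith
  have hs1 : 0 < s + 1 := by linarith
  have hden : 0 < s ^ 2 * (s + 1) := by positivity
  have hVs : s ^ 2 * (s + 1) * ((s + 1) * V) = s ^ 2 * (0.86 * (t + 1) * (s + 1) -
      0.3 * (t + 1) ^ 2) := by
    rw [hV]; field_simp
  have hV₁s : s ^ 2 * V₁ = 0.86 * t * s - 0.3 * t ^ 2 := by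
    rw [hV₁]; field_simp
  have hV₂s : s ^ 2 * V₂ = 0.86 * (t - 1) * s - 0.3 * (t - 1) ^ 2 := by
    rw [hV₂]; field_simp
  have hps : (s + 1) * p = t := by
    rw [hp]; field_simp
  have hN : s ^ 2 * (s + 1) * ((s + 1) * (V - (1 - p) * V₁ - p * V₂)) =
      s ^ 2 * (0.86 * (t + 1) * (s + 1) - 0.3 * (t + 1) ^ 2) -
      (s + 1) * ((s + 1 - t) * (0.86 * t * s - 0.3 * t ^ 2) +
        t * (0.86 * (t - 1) * s - 0.3 * (t - 1) ^ 2)) := by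
    rw [← hVs, ← hV₁s, ← hV₂s, ← hps]; ring
  have hT₁ : s ^ 2 * (s + 1) * (0.99 * ((1 - p) * (1 - V₁) + p * (1 - V₂))) =
      0.99 * ((s + 1 - t) * (s ^ 2 - (0.86 * t * s - 0.3 * t ^ 2)) +
        t * (s ^ 2 - (0.86 * (t - 1) * s - 0.3 * (t - 1) ^ 2))) := by
    rw [← hV₁s, ← hV₂s, ← hps]; ring
  have hq : s ^ 2 * (s + 1) * ((1 - p) * V₁) = (s + 1 - t) * (0.86 * t * s - 0.3 * t ^ 2) := by
    rw [← hV₁s, ← hps]; ring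
  have hq₂ : s ^ 2 * (s + 1) * (p * V₂) = t * (0.86 * (t - 1) * s - 0.3 * (t - 1) ^ 2) := by
    rw [← hV₂s, ← hps]; ring
  have hr : s ^ 2 * (s + 1) * (p * (0.99 * (1 - V₂))) =
      0.99 * (t * (s ^ 2 - (0.86 * (t - 1) * s - 0.3 * (t - 1) ^ 2))) := by
    rw [← hV₂s, ← hps]; ring
  obtain ⟨x, rfl⟩ : ∃ x, t = 1 + x := ⟨t - 1, by ring⟩
  obtain ⟨y, rfl⟩ : ∃ y, s = 1 + x + y := ⟨s - 1 - x, by ring⟩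
  have hx : 0 ≤ x := by linarith
  have hy : 0 ≤ y := by linarith
  have key := le_of_decreasing_weights (N := (1 + x + y + 1) * (V - (1 - p) * V₁ - p * V₂))
    (T₁ := 0.99 * ((1 - p) * (1 - V₁) + p * (1 - V₂)))
    (T₂ := 0.99 * ((1 - p) * (1 - V₁) + p * (1 - V₂)) + p * (0.99 * (1 - V₂)) - (1 - p) * V₁)
    (T₃ := 0.99 * ((1 - p) * (1 - V₁) + p * (1 - V₂)) + p * (0.99 * (1 - V₂)) - (1 - p) * V₁ -
      p * V₂) ?_ ?_ ?_ ?_ hD h12 h23 h3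
  · linarith
  · refine nonneg_of_mul_nonneg_right ?_ hden
    rw [hN]; ring_nf; positivity
  · refine le_of_mul_le_mul_left ?_ hden
    rw [hN, hT₁, ← sub_nonneg]; ring_nf; positivity
  · refine le_of_mul_le_mul_left ?_ hden
    rw [hN, mul_sub (_ * _), mul_add _ (0.99 * _), hT₁, hr, hq, ← sub_nonneg]; ring_nf; positivity
  · refine le_of_mul_le_mul_left ?_ hden
    rw [hN, mul_sub (_ * _), mul_sub (_ * _), mul_add _ (0.99 * _), hT₁, hr, hq, hq₂, ← sub_nonneg]
    have h : 0 ≤ x * (0.0512 * (x - 1.05 * y) ^ 2) := by positivity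
    refine h.trans (le_of_sub_nonneg ?_)
    ring_nf; positivity

/-- The step inequality: `D` is the value of the `r` unseen elements, and `G₁`, `G₂`, `G₃` are the
sums of their gains with respect to the solution after adding zero, one and two elements. -/
theorem guarantee_mix {r b : ℕ} (hb : 2 ≤ b) (hbr : b ≤ r) {D G₁ G₂ G₃ : ℝ}
    (hD : D ≤ G₁) (h12 : G₂ ≤ G₁) (h23 : G₃ ≤ G₂) (h3 : 0 ≤ G₃) :
    ∃ p : ℝ, 0 ≤ p ∧ p ≤ 1 ∧ r * (guarantee r b * D) ≤
      (1 - p) * (r * (guarantee (r - 1) (b - 1) * D) +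
        (0.99 * (1 - guarantee (r - 1) (b - 1)) * G₁ - guarantee (r - 1) (b - 1) * G₂)) +
      p * (r * (guarantee (r - 1) (b - 2) * D) +
        (0.99 * (1 - guarantee (r - 1) (b - 2)) * (G₁ + G₂) - guarantee (r - 1) (b - 2) * G₃)) := by
  obtain ⟨t, rfl⟩ := Nat.exists_eq_add_of_le hb
  obtain ⟨u, rfl⟩ := Nat.exists_eq_add_of_le hbr
  refine ⟨(1 + t : ℝ) / (1 + t + u + 1), by positivity, div_le_one_of_le₀ ?_ (by positivity), ?_⟩
  · linarith [Nat.cast_nonneg (α := ℝ) u]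
  have hr : ((2 + t + u : ℕ) : ℝ) = 1 + t + u + 1 := by push_cast; ring
  rw [hr]
  refine guarantee_mix_real (by simp) (by simp) ?_ ?_ ?_ rfl hD h12 h23 h3
  · rw [guarantee, hr]; push_cast; ring
  · rw [guarantee, show 2 + t - 1 = 1 + t by omega, show 2 + t + u - 1 = 1 + t + u by omega]
    push_cast; ring
  · rw [guarantee, show 2 + t - 2 = t by omega, show 2 + t + u - 1 = 1 + t + u by omega]
    push_cast; ring

theorem guarantee_one_right_le {r : ℕ} (hr : 0 < r) {D G : ℝ} (hD : D ≤ G) (hD0 : 0 ≤ D) :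
    r * (guarantee r 1 * D) ≤ 0.99 * G := by
  have h : (r : ℝ) * guarantee r 1 = 0.86 - 0.3 / r := by
    have : (r : ℝ) ≠ 0 := by positivity
    rw [guarantee]; push_cast; field_simp
  have h' : (0 : ℝ) ≤ 0.3 / r := by positivity
  rw [← mul_assoc, h]
  nlinarith

end Guarantee

section Submodular

variable {U : Type*} [DecidableEq U] {f : Finset U → ℝ} {E : Finset U}

/-- The marginal gain of `e` with respect to `S`. -/
def gain (f : Finset U → ℝ) (S : Finset U) (e : U) : ℝ := f (insert e S) - f S

theorem gain_of_mem {S : Finset U} {e : U} (h : e ∈ S) : gain f S e = 0 := by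
  rw [gain, Finset.insert_eq_of_mem h, sub_self]

namespace IsMonotoneSubmodularOn

theorem gain_nonneg (hf : IsMonotoneSubmodularOn f E) {S : Finset U} (hS : S ⊆ E) {e : U}
    (he : e ∈ E) : 0 ≤ gain f S e :=
  sub_nonneg.2 (hf.mono _ _ (Finset.subset_insert e S) (Finset.insert_subset he hS))

theorem gain_anti (hf : IsMonotoneSubmodularOn f E) {S T : Finset U} (hST : S ⊆ T) (hT : T ⊆ E)
    {e : U} (he : e ∈ E) : gain f T e ≤ gain f S e := by
  by_cases heT : e ∈ T
  · rw [gain_of_mem heT]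
    exact hf.gain_nonneg (hST.trans hT) he
  · have h := hf.submodular (insert e S) T (Finset.insert_subset he (hST.trans hT)) hT
    rw [Finset.insert_union, Finset.union_eq_right.2 hST, Finset.insert_inter_of_notMem heT,
      Finset.inter_eq_left.2 hST] at h
    unfold gain
    linarith

theorem union_le_add_sum_gain (hf : IsMonotoneSubmodularOn f E) {S R : Finset U} (hS : S ⊆ E)
    (hR : R ⊆ E) : f (R ∪ S) - f S ≤ ∑ o ∈ R, gain f S o := by
  induction R using Finset.induction_on with
  | empty => simp
  | insert e R he ih =>
    rw [Finset.insert_subset_iff] at hR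
    rw [Finset.sum_insert he, Finset.insert_union]
    have h := hf.gain_anti (Finset.subset_union_right : S ⊆ R ∪ S)
      (Finset.union_subset hR.2 hS) hR.1
    have := ih hR.2
    unfold gain at h ⊢
    unfold gain at this
    linarith

/-- Dropping an unseen element costs at most its gain. -/
theorem le_erase_union_add_gain (hf : IsMonotoneSubmodularOn f E) {S R : Finset U} (hS : S ⊆ E)
    (hR : R ⊆ E) {o : U} (ho : o ∈ R) : f (R ∪ S) ≤ f (R.erase o ∪ S) + gain f S o := by
  have h := hf.gain_anti (Finset.subset_union_right : S ⊆ R.erase o ∪ S)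
    (Finset.union_subset ((Finset.erase_subset _ _).trans hR) hS) (hR ho)
  rw [gain, ← Finset.insert_union, Finset.insert_erase ho] at h
  linarith

end IsMonotoneSubmodularOn

end Submodular

section Levels

/-- The logarithm of a positive gain to the base `1.01`, rounded down. -/
noncomputable def gainLevel (x : ℝ) : WithBot ℤ :=
  if 0 < x then ((⌊Real.logb 1.01 x⌋ : ℤ) : WithBot ℤ) else ⊥

theorem bot_lt_gainLevel {x : ℝ} : ⊥ < gainLevel x ↔ 0 < x := by
  unfold gainLevel
  split_ifs with h <;> simp [h]

theorem gainLevel_mono : Monotone gainLevel := by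
  intro x y h
  unfold gainLevel
  split_ifs with hx hy
  · exact WithBot.coe_le_coe.2 (Int.floor_mono (Real.logb_le_logb_of_le (by norm_num) hx h))
  · exact absurd (hx.trans_le h) hy
  · exact bot_le
  · exact le_rfl

theorem le_of_gainLevel_le {x y : ℝ} (hx : 0 < x) (h : gainLevel x ≤ gainLevel y) :
    0.99 * x ≤ y := by
  have hy : 0 < y := bot_lt_gainLevel.1 ((bot_lt_gainLevel.2 hx).trans_le h)
  rw [gainLevel, gainLevel, if_pos hx, if_pos hy, WithBot.coe_le_coe] at h
  have h1 : Real.logb 1.01 x < Real.logb 1.01 (1.01 * y) := by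
    rw [Real.logb_mul (by norm_num) hy.ne', Real.logb_self_eq_one (by norm_num)]
    have h2 := Int.lt_floor_add_one (Real.logb 1.01 x)
    have h3 := Int.floor_le (Real.logb 1.01 y)
    have h4 : ((⌊Real.logb 1.01 x⌋ : ℤ) : ℝ) ≤ (⌊Real.logb 1.01 y⌋ : ℤ) := by exact_mod_cast h
    linarith
  have := (Real.logb_lt_logb_iff (by norm_num) hx (by positivity)).1 h1
  linarith

/-- The level `L` steps below `l`. -/
def lowerLevel (L : ℕ) (l : WithBot ℤ) : WithBot ℤ := l.map fun z => z - L

theorem lowerLevel_le (L : ℕ) (l : WithBot ℤ) : lowerLevel L l ≤ l := by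
  induction l with
  | bot => exact le_rfl
  | coe z => exact WithBot.coe_le_coe.2 (sub_le_self z (Nat.cast_nonneg L))

theorem lowerLevel_mono (L : ℕ) : Monotone (lowerLevel L) := by
  intro l l' h
  induction l with
  | bot => exact bot_le
  | coe z =>
    induction l' with
    | bot => simp at h
    | coe z' => exact WithBot.coe_le_coe.2 (sub_le_sub_right (WithBot.coe_le_coe.1 h) _)

theorem le_of_not_lowerLevel_le {L : ℕ} {m x : ℝ} (hm : 0 ≤ m)
    (h : ¬ (lowerLevel L (gainLevel m) ≤ gainLevel x ∧ ⊥ < gainLevel x)) :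
    x ≤ m / 1.01 ^ L := by
  by_cases hx : 0 < x
  · rw [bot_lt_gainLevel, and_iff_left hx] at h
    obtain rfl | hm := hm.eq_or_lt
    · exact absurd (by simp [gainLevel, lowerLevel]) h
    rw [gainLevel, gainLevel, if_pos hx, if_pos hm, lowerLevel, WithBot.map_coe,
      WithBot.coe_le_coe, not_le] at h
    have h1 : Real.logb 1.01 x < Real.logb 1.01 (m / 1.01 ^ L) := by
      rw [Real.logb_div hm.ne' (by positivity), Real.logb_pow, Real.logb_self_eq_one (by norm_num)]
      have h2 := Int.lt_floor_add_one (Real.logb 1.01 x)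
      have h3 := Int.floor_le (Real.logb 1.01 m)
      have h4 : ((⌊Real.logb 1.01 x⌋ : ℤ) : ℝ) + 1 ≤ (⌊Real.logb 1.01 m⌋ : ℤ) - L := by
        exact_mod_cast h
      linarith
    exact ((Real.logb_lt_logb_iff (by norm_num) hx (by positivity)).1 h1).le
  · exact (not_lt.1 hx).trans (by positivity)

theorem hundred_mul_le_pow (k : ℕ) : (100 * k : ℝ) ≤ 1.01 ^ (10000 * k) := by
  have := one_add_mul_le_pow (show (-2 : ℝ) ≤ 0.01 by norm_num) (10000 * k)
  push_cast at this
  norm_num at this ⊢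
  linarith

end Levels

section Game

variable {U : Type*} [DecidableEq U] {f : Finset U → ℝ} {E : Finset U}

/-- The class of `e` with respect to the path `p`: the rounded logarithm of its marginal gain. -/
noncomputable def gainClass (f : Finset U → ℝ) (p : List U) (e : U) : WithBot ℤ :=
  gainLevel (gain f p.toFinset e)

variable {k : ℕ} {J : WithBot ℤ} {a : ℝ}

/-- When `o` arrives, every path that does not yet contain `o` has an extension that gains almost as
much as `o`, unless the gain of `o` is small. -/
theorem exists_follow (ha : 0 ≤ a)
    (hJ : ∀ x, ¬ (J ≤ gainLevel x ∧ ⊥ < gainLevel x) → x ≤ a) {u p : List U} {o : U}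
    (hp : p ∈ recordTree (gainClass f) k J u ∨
      o ∈ p ∧ p ∈ recordTree (gainClass f) k J (u ++ [o])) (hk : p.length < k) :
    ∃ p', (p' ∈ recordTree (gainClass f) k J u ∨
        o ∈ p' ∧ p' ∈ recordTree (gainClass f) k J (u ++ [o])) ∧
      p.toFinset ⊆ p'.toFinset ∧ p'.length ≤ p.length + 1 ∧
      f p.toFinset + 0.99 * gain f p.toFinset o - a ≤ f p'.toFinset := by
  obtain hp | hp := hp
  · by_cases hs : J ≤ gainClass f p o ∧ ⊥ < gainClass f p o
    · have hpos : 0 < gain f p.toFinset o := bot_lt_gainLevel.1 hs.2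
      obtain ⟨c, hc, hle⟩ | h := exists_extension_or hp hk hs.1 hs.2
      · refine ⟨c :: p, Or.inl hc, by simp, by simp, ?_⟩
        have := le_of_gainLevel_le hpos hle
        rw [List.toFinset_cons]
        unfold gain at this ⊢
        linarith
      · refine ⟨o :: p, Or.inr ⟨by simp, h⟩, by simp, by simp, ?_⟩
        rw [List.toFinset_cons]
        unfold gain at hpos ⊢
        linarith
    · refine ⟨p, Or.inl hp, subset_rfl, by simp, ?_⟩
      have := hJ _ hs
      linarith
  · refine ⟨p, Or.inr hp, subset_rfl, by simp, ?_⟩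
    rw [gain_of_mem (List.mem_toFinset.2 hp.1)]
    linarith

/-- Lower bound on what the path `p` can still reach when the elements of `R` are unseen and `b`
elements can be added. -/
noncomputable def potential (f : Finset U → ℝ) (a : ℝ) (R : Finset U) (p : List U) (b : ℕ) : ℝ :=
  f p.toFinset + guarantee R.card b * (f (R ∪ p.toFinset) - f p.toFinset) - b * a

theorem le_potential_erase (hf : IsMonotoneSubmodularOn f E) {R S S' : Finset U} (hR : R ⊆ E)
    (hS' : S' ⊆ E) (hSS : S ⊆ S') {o : U} (ho : o ∈ R) {V y : ℝ} (hV0 : 0 ≤ V) (hV1 : V ≤ 1)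
    (hy : f S + y ≤ f S') :
    f S + V * (f (R ∪ S) - f S) + ((1 - V) * y - V * gain f S' o) ≤
      f S' + V * (f (R.erase o ∪ S') - f S') := by
  have h1 := hf.le_erase_union_add_gain hS' hR ho
  have h2 := hf.mono (R ∪ S) (R ∪ S') (Finset.union_subset_union_right hSS)
    (Finset.union_subset hR hS')
  have h3 : f (R ∪ S) - gain f S' o ≤ f (R.erase o ∪ S') := by linarith
  nlinarith [mul_le_mul_of_nonneg_left h3 hV0, mul_le_mul_of_nonneg_left hy (sub_nonneg.2 hV1)]

/-- If a uniformly random element of `R` arrives next, then the potential does not decrease in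
expectation. -/
theorem card_mul_potential_le_sum {ι : Type*} (hf : IsMonotoneSubmodularOn f E) (ha : 0 ≤ a)
    (hJ : ∀ x, ¬ (J ≤ gainLevel x ∧ ⊥ < gainLevel x) → x ≤ a) {u p : List U}
    (hu : u.toFinset ⊆ E) {O : Finset ι} {g : ι ↪ U} (hR : O.map g ⊆ E)
    (hp : p ∈ recordTree (gainClass f) k J u) {b : ℕ} (hbk : p.length + b ≤ k)
    (hb : b ≤ O.card) {w : ι → ℝ}
    (hw : ∀ o ∈ O, ∀ p' ∈ recordTree (gainClass f) k J (u ++ [g o]), ∀ b', p'.length + b' ≤ k →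
      b' ≤ O.card - 1 → potential f a ((O.map g).erase (g o)) p' b' ≤ w o) :
    O.card * potential f a (O.map g) p b ≤ ∑ o ∈ O, w o := by
  have hE : ∀ o ∈ O, ∀ p' ∈ recordTree (gainClass f) k J (u ++ [g o]), p'.toFinset ⊆ E := by
    intro o ho p' hp' x hx
    have := subset_of_mem_recordTree hp' (List.mem_toFinset.1 hx)
    obtain h | h := List.mem_append.1 this
    · exact hu (List.mem_toFinset.2 h)
    · rw [List.mem_singleton.1 h]
      exact hR (Finset.mem_map_of_mem _ ho)
  have hpE : p.toFinset ⊆ E := fun x hx =>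
    hu (List.mem_toFinset.2 (subset_of_mem_recordTree hp (List.mem_toFinset.1 hx)))
  have hmono : ∀ o p', (p' ∈ recordTree (gainClass f) k J u ∨
      g o ∈ p' ∧ p' ∈ recordTree (gainClass f) k J (u ++ [g o])) →
      p' ∈ recordTree (gainClass f) k J (u ++ [g o]) := fun o p' h =>
    h.elim (fun h => recordTree_subset_append _ _ h) And.right
  have hcard : ∀ o ∈ O, ((O.map g).erase (g o)).card = O.card - 1 := fun o ho => by
    rw [Finset.card_erase_of_mem (Finset.mem_map_of_mem _ ho), Finset.card_map]
  set D := f (O.map g ∪ p.toFinset) - f p.toFinset with hDdef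
  have hD : D ≤ ∑ o ∈ O, gain f p.toFinset (g o) := by
    have := hf.union_le_add_sum_gain hpE hR
    rwa [Finset.sum_map] at this
  have hD0 : 0 ≤ D := sub_nonneg.2
    (hf.mono _ _ Finset.subset_union_right (Finset.union_subset hR hpE))
  have hpot : potential f a (O.map g) p b = f p.toFinset + guarantee O.card b * D - b * a := by
    rw [potential, Finset.card_map]
  rcases Nat.lt_trichotomy b 1 with hb1 | rfl | hb2
  · obtain rfl : b = 0 := by omega
    rw [hpot, ← nsmul_eq_mul]
    refine Finset.card_nsmul_le_sum _ _ _ fun o ho => le_trans (le_of_eq ?_)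
      (hw o ho p (recordTree_subset_append _ _ hp) 0 hbk (Nat.zero_le _))
    simp [potential]
  · have h1 : ∀ o ∈ O, f p.toFinset - a + 0.99 * gain f p.toFinset (g o) ≤ w o := by
      intro o ho
      obtain ⟨p₁, hp₁, -, hl₁, hf₁⟩ := exists_follow ha hJ (Or.inl hp) (o := g o) (by omega)
      have := hw o ho p₁ (hmono o p₁ hp₁) 0 (by omega) (Nat.zero_le _)
      simp only [potential, guarantee_zero_right, Nat.cast_zero, zero_mul, add_zero,
        sub_zero] at this
      linarith
    have h2 := Finset.sum_le_sum h1
    rw [Finset.sum_add_distrib, Finset.sum_const, ← Finset.mul_sum, nsmul_eq_mul] at h2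
    have h3 := guarantee_one_right_le (r := O.card) (by omega) hD hD0
    rw [hpot]
    push_cast
    linarith
  · set V₁ := guarantee (O.card - 1) (b - 1) with hV₁
    set V₂ := guarantee (O.card - 1) (b - 2) with hV₂
    have hV₁0 : 0 ≤ V₁ := guarantee_nonneg (by omega)
    have hV₂0 : 0 ≤ V₂ := guarantee_nonneg (by omega)
    have hV₁1 : V₁ ≤ 1 := guarantee_le_one _ _
    have hV₂1 : V₂ ≤ 1 := guarantee_le_one _ _
    have h1 : ∀ o, ∃ g₂ g₃ : ℝ, o ∈ O →
        g₂ ≤ gain f p.toFinset (g o) ∧ g₃ ≤ g₂ ∧ 0 ≤ g₃ ∧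
        f p.toFinset - b * a + (V₁ * D + (0.99 * (1 - V₁) * gain f p.toFinset (g o) -
          V₁ * g₂)) ≤ w o ∧
        f p.toFinset - b * a + (V₂ * D + (0.99 * (1 - V₂) * (gain f p.toFinset (g o) + g₂) -
          V₂ * g₃)) ≤ w o := by
      intro o
      by_cases ho : o ∈ O
      swap
      · exact ⟨0, 0, fun h => absurd h ho⟩
      have hoR := Finset.mem_map_of_mem g ho
      obtain ⟨p₁, hp₁, hs₁, hl₁, hf₁⟩ := exists_follow ha hJ (Or.inl hp) (o := g o) (by omega)
      obtain ⟨p₂, hp₂, hs₂, hl₂, hf₂⟩ := exists_follow ha hJ hp₁ (by omega)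
      have hE₁ := hE o ho p₁ (hmono o p₁ hp₁)
      have hE₂ := hE o ho p₂ (hmono o p₂ hp₂)
      refine ⟨gain f p₁.toFinset (g o), gain f p₂.toFinset (g o), fun _ =>
        ⟨hf.gain_anti hs₁ hE₁ (hR hoR), hf.gain_anti hs₂ hE₂ (hR hoR),
          hf.gain_nonneg hE₂ (hR hoR), ?_, ?_⟩⟩
      · have h := hw o ho p₁ (hmono o p₁ hp₁) (b - 1) (by omega) (by omega)
        rw [potential, hcard o ho, ← hV₁, Nat.cast_sub (by omega)] at h
        have h' := le_potential_erase hf hR hE₁ hs₁ hoR hV₁0 hV₁1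
          (y := 0.99 * gain f p.toFinset (g o) - a) (by linarith)
        rw [← hDdef] at h'
        push_cast at h
        linarith [mul_nonneg hV₁0 ha]
      · have h := hw o ho p₂ (hmono o p₂ hp₂) (b - 2) (by omega) (by omega)
        rw [potential, hcard o ho, ← hV₂, Nat.cast_sub (by omega)] at h
        have h' := le_potential_erase hf hR hE₂ (hs₁.trans hs₂) hoR hV₂0 hV₂1
          (y := 0.99 * (gain f p.toFinset (g o) + gain f p₁.toFinset (g o)) - 2 * a)
          (by linarith)
        rw [← hDdef] at h'
        push_cast at h
        linarith [mul_nonneg hV₂0 ha]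
    choose g₂ g₃ h1 using h1
    obtain ⟨θ, hθ0, hθ1, hθ⟩ := guarantee_mix hb2 hb hD
      (Finset.sum_le_sum fun o ho => (h1 o ho).1) (Finset.sum_le_sum fun o ho => (h1 o ho).2.1)
      (Finset.sum_nonneg fun o ho => (h1 o ho).2.2.1)
    rw [← hV₁, ← hV₂] at hθ
    have hsum₁ := Finset.sum_le_sum fun o ho => (h1 o ho).2.2.2.1
    have hsum₂ := Finset.sum_le_sum fun o ho => (h1 o ho).2.2.2.2
    simp only [Finset.sum_add_distrib, Finset.sum_sub_distrib, Finset.sum_const, nsmul_eq_mul,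
      ← Finset.mul_sum] at hsum₁ hsum₂
    have h₁ := mul_le_mul_of_nonneg_left hsum₁ (sub_nonneg.2 hθ1)
    have h₂ := mul_le_mul_of_nonneg_left hsum₂ hθ0
    rw [hpot]
    linarith

end Game

section ArrivalOrder

variable {U : Type*} [DecidableEq U] {n : ℕ} (σ : Fin n ↪ U) (G : Finset (Fin n))

@[simp]
theorem length_arrivalOrder (π : Equiv.Perm {i // i ∈ G}) : (arrivalOrder σ G π).length = n := by
  simp [arrivalOrder]

theorem nodup_arrivalOrder (π : Equiv.Perm {i // i ∈ G}) : (arrivalOrder σ G π).Nodup :=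
  List.nodup_ofFn.2 (σ.injective.comp (Equiv.injective _))

theorem toFinset_arrivalOrder (π : Equiv.Perm {i // i ∈ G}) :
    (arrivalOrder σ G π).toFinset = Finset.univ.map σ := by
  ext x
  simp only [arrivalOrder, List.mem_toFinset, List.mem_ofFn, Finset.mem_map, Finset.mem_univ,
    true_and]
  exact ⟨fun ⟨i, hi⟩ => ⟨_, hi⟩, fun ⟨i, hi⟩ => ⟨(Equiv.Perm.ofSubtype π).symm i, by simpa⟩⟩

theorem mem_take_arrivalOrder (π : Equiv.Perm {i // i ∈ G}) {i : ℕ} {x : U} :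
    x ∈ (arrivalOrder σ G π).take i ↔ ∃ l : Fin n, l < i ∧ σ (Equiv.Perm.ofSubtype π l) = x := by
  rw [List.mem_take_iff_getElem]
  simp only [arrivalOrder, List.length_ofFn, List.getElem_ofFn, lt_inf_iff]
  exact ⟨fun ⟨l, h, hx⟩ => ⟨⟨l, h.2⟩, h.1, hx⟩, fun ⟨l, h, hx⟩ => ⟨l, ⟨h, l.2⟩, hx⟩⟩

theorem take_arrivalOrder_congr {π π' : Equiv.Perm {i // i ∈ G}} {i : ℕ}
    (h : ∀ l : {i // i ∈ G}, (l : Fin n) < i → π l = π' l) :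
    (arrivalOrder σ G π).take i = (arrivalOrder σ G π').take i := by
  refine List.ext_getElem (by simp) fun l hl hl' => ?_
  rw [List.length_take, lt_inf_iff, length_arrivalOrder] at hl
  simp only [arrivalOrder, List.getElem_take, List.getElem_ofFn]
  by_cases hG : (⟨l, hl.2⟩ : Fin n) ∈ G
  · rw [Equiv.Perm.ofSubtype_apply_of_mem _ hG, Equiv.Perm.ofSubtype_apply_of_mem _ hG,
      h ⟨_, hG⟩ hl.1]
  · rw [Equiv.Perm.ofSubtype_apply_of_not_mem _ hG, Equiv.Perm.ofSubtype_apply_of_not_mem _ hG]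

theorem take_succ_arrivalOrder (π : Equiv.Perm {i // i ∈ G}) (i : Fin n) :
    (arrivalOrder σ G π).take (i + 1) =
      (arrivalOrder σ G π).take i ++ [σ (Equiv.Perm.ofSubtype π i)] := by
  rw [List.take_succ_eq_append_getElem (by simp)]
  simp [arrivalOrder]

end ArrivalOrder

section Averaging

variable {n : ℕ} (G : Finset (Fin n))

/-- The permutations that agree with `π₀` on the positions before `i`. -/
def agreeing (i : ℕ) (π₀ : Equiv.Perm {i // i ∈ G}) : Finset (Equiv.Perm {i // i ∈ G}) :=
  Finset.univ.filter fun π => ∀ l : {i // i ∈ G}, (l : Fin n) < i → π l = π₀ l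

/-- The elements that `π₀` does not use at the positions before `i`. -/
def remaining (i : ℕ) (π₀ : Equiv.Perm {i // i ∈ G}) : Finset {i // i ∈ G} :=
  Finset.univ.filter fun j => ∀ l : {i // i ∈ G}, (l : Fin n) < i → π₀ l ≠ j

variable {G}

theorem mem_agreeing {i : ℕ} {π₀ π : Equiv.Perm {i // i ∈ G}} :
    π ∈ agreeing G i π₀ ↔ ∀ l : {i // i ∈ G}, (l : Fin n) < i → π l = π₀ l := by
  simp [agreeing]

theorem mem_remaining {i : ℕ} {π₀ : Equiv.Perm {i // i ∈ G}} {j : {i // i ∈ G}} :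
    j ∈ remaining G i π₀ ↔ ∀ l : {i // i ∈ G}, (l : Fin n) < i → π₀ l ≠ j := by
  simp [remaining]

/-- The permutation that continues `π₀` with `o` at position `i`. -/
def redirect (i : {i // i ∈ G}) (π₀ : Equiv.Perm {i // i ∈ G}) (o : {i // i ∈ G}) :
    Equiv.Perm {i // i ∈ G} := Equiv.swap (π₀ i) o * π₀

@[simp]
theorem redirect_apply_self (i : {i // i ∈ G}) (π₀ : Equiv.Perm {i // i ∈ G}) (o : {i // i ∈ G}) :
    redirect i π₀ o i = o := by
  simp [redirect]

theorem redirect_apply {i : {i // i ∈ G}} {π₀ : Equiv.Perm {i // i ∈ G}} {o : {i // i ∈ G}}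
    (ho : o ∈ remaining G (i : Fin n) π₀) {l : {i // i ∈ G}} (hl : (l : Fin n) < (i : Fin n)) :
    redirect i π₀ o l = π₀ l := by
  rw [redirect, Equiv.Perm.mul_apply, Equiv.swap_apply_of_ne_of_ne]
  · intro h
    rw [π₀.injective h] at hl
    exact lt_irrefl _ hl
  · exact mem_remaining.1 ho l hl

theorem mem_agreeing_redirect {i : {i // i ∈ G}} {π₀ π : Equiv.Perm {i // i ∈ G}}
    {o : {i // i ∈ G}} (ho : o ∈ remaining G (i : Fin n) π₀) :
    π ∈ agreeing G ((i : Fin n) + 1) (redirect i π₀ o) ↔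
      π ∈ agreeing G (i : Fin n) π₀ ∧ π i = o := by
  simp only [mem_agreeing]
  constructor
  · intro h
    refine ⟨fun l hl => ?_, ?_⟩
    · rw [h l (by omega), redirect_apply ho hl]
    · rw [h i (by omega), redirect_apply_self]
  · rintro ⟨h, hi⟩ l hl
    obtain hl | hl := Nat.lt_succ_iff_lt_or_eq.1 hl
    · rw [h l hl, redirect_apply ho hl]
    · obtain rfl : l = i := Subtype.ext (Fin.ext hl)
      rw [hi, redirect_apply_self]

theorem apply_mem_remaining {i : {i // i ∈ G}} {π₀ π : Equiv.Perm {i // i ∈ G}}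
    (h : π ∈ agreeing G (i : Fin n) π₀) : π i ∈ remaining G (i : Fin n) π₀ := by
  rw [mem_remaining]
  intro l hl hli
  rw [← mem_agreeing.1 h l hl] at hli
  rw [π.injective hli] at hl
  exact lt_irrefl _ hl

theorem sum_agreeing (i : {i // i ∈ G}) (π₀ : Equiv.Perm {i // i ∈ G})
    (X : Equiv.Perm {i // i ∈ G} → ℝ) :
    ∑ π ∈ agreeing G (i : Fin n) π₀, X π = ∑ o ∈ remaining G (i : Fin n) π₀,
      ∑ π ∈ agreeing G ((i : Fin n) + 1) (redirect i π₀ o), X π := by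
  rw [← Finset.sum_fiberwise_of_maps_to fun π hπ => apply_mem_remaining hπ]
  refine Finset.sum_congr rfl fun o ho => Finset.sum_congr ?_ fun _ _ => rfl
  ext π
  rw [mem_agreeing_redirect ho, Finset.mem_filter]

theorem card_agreeing_mul (i : ℕ) (π₀ τ : Equiv.Perm {i // i ∈ G}) :
    (agreeing G i (τ * π₀)).card = (agreeing G i π₀).card := by
  refine Finset.card_bij' (fun π _ => τ⁻¹ * π) (fun π _ => τ * π) ?_ ?_ ?_ ?_
  · intro π hπ
    rw [mem_agreeing] at hπ ⊢
    intro l hl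
    simp [hπ l hl]
  · intro π hπ
    rw [mem_agreeing] at hπ ⊢
    intro l hl
    simp [hπ l hl]
  · simp
  · simp

theorem card_agreeing (i : {i // i ∈ G}) (π₀ : Equiv.Perm {i // i ∈ G}) :
    ((agreeing G (i : Fin n) π₀).card : ℝ) =
      (remaining G (i : Fin n) π₀).card * (agreeing G ((i : Fin n) + 1) π₀).card := by
  have h := sum_agreeing i π₀ fun _ => 1
  simp only [Finset.sum_const, nsmul_eq_mul, mul_one, redirect, card_agreeing_mul] at h
  exact h

end Averaging

section Analysis

variable {U : Type*} [DecidableEq U] {f : Finset U → ℝ} {n : ℕ} {σ : Fin n ↪ U}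
  {G : Finset (Fin n)} {T : Finset U}

/-- The embedding of the good elements. -/
def goodEmbedding (σ : Fin n ↪ U) (G : Finset (Fin n)) : {i // i ∈ G} ↪ U :=
  (Function.Embedding.subtype _).trans σ

theorem sdiff_take_eq_map (hT : T ⊆ G.map σ) (i : ℕ) (π₀ : Equiv.Perm {i // i ∈ G}) :
    T \ ((arrivalOrder σ G π₀).take i).toFinset =
      ((remaining G i π₀).filter fun j : {i // i ∈ G} => σ j ∈ T).map (goodEmbedding σ G) := by
  ext x
  simp only [Finset.mem_sdiff, List.mem_toFinset, mem_take_arrivalOrder, Finset.mem_map,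
    Finset.mem_filter, mem_remaining]
  constructor
  · rintro ⟨hx, hu⟩
    obtain ⟨j, hj, rfl⟩ := Finset.mem_map.1 (hT hx)
    refine ⟨⟨j, hj⟩, ⟨fun l hl h => hu ⟨l, hl, ?_⟩, hx⟩, rfl⟩
    rw [Equiv.Perm.ofSubtype_apply_of_mem _ l.2, h]
  · rintro ⟨j, ⟨hj, hx⟩, rfl⟩
    refine ⟨hx, ?_⟩
    rintro ⟨l, hl, h⟩
    have h : Equiv.Perm.ofSubtype π₀ l = j := σ.injective h
    by_cases hG : l ∈ G
    · rw [Equiv.Perm.ofSubtype_apply_of_mem _ hG] at h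
      exact hj ⟨l, hG⟩ hl (Subtype.ext h)
    · rw [Equiv.Perm.ofSubtype_apply_of_not_mem _ hG] at h
      exact hG (h ▸ j.2)

theorem sdiff_union_singleton (A B : Finset U) (x : U) : A \ (B ∪ {x}) = (A \ B).erase x := by
  ext y
  simp only [Finset.mem_sdiff, Finset.mem_union, Finset.mem_singleton, Finset.mem_erase]
  tauto

theorem card_mul_potential_le_sum_agreeing (hf : IsMonotoneSubmodularOn f (Finset.univ.map σ))
    (hT : T ⊆ G.map σ) {k : ℕ} {J : WithBot ℤ} {a : ℝ} (ha : 0 ≤ a)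
    (hJ : ∀ x, ¬ (J ≤ gainLevel x ∧ ⊥ < gainLevel x) → x ≤ a) {F : List U → ℝ}
    (hF : ∀ s, ∀ p ∈ recordTree (gainClass f) k J s, f p.toFinset ≤ F s) {i : ℕ} (hi : i ≤ n)
    (π₀ : Equiv.Perm {i // i ∈ G}) {p : List U}
    (hp : p ∈ recordTree (gainClass f) k J ((arrivalOrder σ G π₀).take i)) {b : ℕ}
    (hbk : p.length + b ≤ k) (hb : b ≤ (T \ ((arrivalOrder σ G π₀).take i).toFinset).card) :
    (agreeing G i π₀).card * potential f a (T \ ((arrivalOrder σ G π₀).take i).toFinset) p b ≤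
      ∑ π ∈ agreeing G i π₀, F (arrivalOrder σ G π) := by
  induction hd : n - i generalizing i π₀ p b with
  | zero =>
    obtain rfl : i = n := by omega
    have hA : agreeing G i π₀ = {π₀} := by
      ext π
      rw [mem_agreeing, Finset.mem_singleton]
      exact ⟨fun h => Equiv.ext fun l => h l l.1.2, fun h l _ => by rw [h]⟩
    rw [List.take_of_length_le (by simp)] at hp hb ⊢
    have hR : T \ (arrivalOrder σ G π₀).toFinset = ∅ := by
      rw [toFinset_arrivalOrder, Finset.sdiff_eq_empty_iff_subset]
      exact hT.trans (Finset.map_subset_map.2 (Finset.subset_univ _))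
    rw [hR] at hb ⊢
    obtain rfl : b = 0 := by simpa using hb
    rw [hA]
    simpa [potential] using hF _ _ hp
  | succ d ih =>
    have hin : i < n := by omega
    by_cases hG : (⟨i, hin⟩ : Fin n) ∈ G
    · set i' : {i // i ∈ G} := ⟨⟨i, hin⟩, hG⟩ with hi'
      have htake : ∀ o ∈ remaining G i π₀, (arrivalOrder σ G (redirect i' π₀ o)).take (i + 1) =
          (arrivalOrder σ G π₀).take i ++ [goodEmbedding σ G o] := by
        intro o ho
        have h := take_succ_arrivalOrder σ G (redirect i' π₀ o) ⟨i, hin⟩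
        rw [Equiv.Perm.ofSubtype_apply_of_mem _ hG, redirect_apply_self] at h
        rw [h, take_arrivalOrder_congr σ G fun l hl => redirect_apply (i := i') ho hl]
        rfl
      set c : ℝ := ((agreeing G (i + 1) π₀).card : ℝ) with hc
      have hcpos : 0 < c := by
        rw [hc, Nat.cast_pos, Finset.card_pos]
        exact ⟨π₀, mem_agreeing.2 fun _ _ => rfl⟩
      set w : {i // i ∈ G} → ℝ := fun o =>
        (∑ π ∈ agreeing G (i + 1) (redirect i' π₀ o), F (arrivalOrder σ G π)) / c with hw
      have hR := sdiff_take_eq_map hT i π₀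
      set u := (arrivalOrder σ G π₀).take i with hu
      set O := (remaining G i π₀).filter fun j : {i // i ∈ G} => σ j ∈ T with hO
      have hstep : ∀ o ∈ remaining G i π₀, ∀ p' ∈ recordTree (gainClass f) k J
          (u ++ [goodEmbedding σ G o]), ∀ b', p'.length + b' ≤ k →
          b' ≤ ((T \ u.toFinset).erase (goodEmbedding σ G o)).card →
          potential f a ((T \ u.toFinset).erase (goodEmbedding σ G o)) p' b' ≤ w o := by
        intro o ho p' hp' b' hbk' hb'
        have h := ih (i := i + 1) hin (redirect i' π₀ o) (p := p') (b := b')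
        rw [htake o ho, List.toFinset_append, List.toFinset_cons, List.toFinset_nil,
          insert_empty_eq, sdiff_union_singleton] at h
        have h := h hp' hbk' hb' (by omega)
        rw [redirect, card_agreeing_mul] at h
        rwa [hw, le_div_iff₀' hcpos]
      have hu' : u.toFinset ⊆ Finset.univ.map σ := by
        rw [← toFinset_arrivalOrder σ G π₀]
        exact fun x hx => List.mem_toFinset.2 (List.mem_of_mem_take (List.mem_toFinset.1 hx))
      have hgood : (O.card : ℝ) * potential f a (T \ u.toFinset) p b ≤ ∑ o ∈ O, w o := by
        rw [hR] at hb ⊢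
        refine card_mul_potential_le_sum hf ha hJ hu' ?_ hp hbk (by simpa using hb) ?_
        · rw [← hR]
          exact Finset.sdiff_subset.trans
            (hT.trans (Finset.map_subset_map.2 (Finset.subset_univ _)))
        · intro o ho p' hp' b' hbk' hb'
          rw [← hR]
          refine hstep o (Finset.mem_filter.1 ho).1 p' hp' b' hbk' (hb'.trans_eq ?_)
          rw [hR, Finset.card_erase_of_mem (Finset.mem_map_of_mem _ ho), Finset.card_map]
      have hnoise : ∀ o ∈ (remaining G i π₀).filter fun j : {i // i ∈ G} => ¬ σ j ∈ T,
          potential f a (T \ u.toFinset) p b ≤ w o := by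
        intro o ho
        rw [Finset.mem_filter] at ho
        have h := hstep o ho.1 p (recordTree_subset_append _ _ hp) b hbk
        have hoT : goodEmbedding σ G o ∉ T \ u.toFinset := fun h => ho.2 (Finset.mem_sdiff.1 h).1
        rw [Finset.erase_eq_of_notMem hoT] at h
        exact h hb
      have hnoise := Finset.card_nsmul_le_sum _ _ _ hnoise
      have hcard := card_agreeing i' π₀
      have hsum := sum_agreeing i' π₀ fun π => F (arrivalOrder σ G π)
      have hwsum : ∑ o ∈ remaining G i π₀, w o * c =
          ∑ π ∈ agreeing G i π₀, F (arrivalOrder σ G π) := by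
        rw [hi'] at hsum
        rw [hsum]
        exact Finset.sum_congr rfl fun o _ => div_mul_cancel₀ _ hcpos.ne'
      rw [← hwsum, ← Finset.sum_mul, ← Finset.sum_filter_add_sum_filter_not _ fun j : {i // i ∈ G} => σ j ∈ T]
      rw [nsmul_eq_mul] at hnoise
      have hQ : ((remaining G i π₀).card : ℝ) =
          O.card + ((remaining G i π₀).filter fun j : {i // i ∈ G} => ¬ σ j ∈ T).card := by
        exact_mod_cast (Finset.card_filter_add_card_filter_not _).symm
      change ((agreeing G i π₀).card : ℝ) = (remaining G i π₀).card * c at hcard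
      rw [hcard, hQ, mul_right_comm]
      refine mul_le_mul_of_nonneg_right ?_ hcpos.le
      rw [add_mul]
      exact add_le_add hgood hnoise
    · have hA : agreeing G (i + 1) π₀ = agreeing G i π₀ := by
        ext π
        simp only [mem_agreeing]
        refine forall_congr' fun l => ?_
        have : (l : Fin n).val ≠ i := fun h => hG ((Fin.ext h : (l : Fin n) = ⟨i, hin⟩) ▸ l.2)
        rw [Nat.lt_succ_iff_lt_or_eq, or_iff_left this]
      have htake := take_succ_arrivalOrder σ G π₀ ⟨i, hin⟩
      rw [Equiv.Perm.ofSubtype_apply_of_not_mem _ hG] at htake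
      have h := ih (i := i + 1) hin π₀ (p := p) (b := b)
      have hnT : σ ⟨i, hin⟩ ∉ T := fun hx => hG ((Finset.mem_map' σ).1 (hT hx))
      simp only at htake
      rw [htake, List.toFinset_append, List.toFinset_cons, List.toFinset_nil, insert_empty_eq,
        sdiff_union_singleton,
        Finset.erase_eq_of_notMem fun h => hnT (Finset.mem_sdiff.1 h).1, hA] at h
      exact h (recordTree_subset_append _ _ hp) hbk hb (by omega)

end Analysis

section Algorithm

variable {U : Type*} [DecidableEq U] {f : Finset U → ℝ}

/-- The least class that is recorded: `10000 * k` levels below the largest class of an element. -/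
noncomputable def recordCutoff (f : Finset U → ℝ) (k : ℕ) (S : Finset U) : WithBot ℤ :=
  lowerLevel (10000 * k) (S.sup (gainClass f []))

/-- The record tree of the stream `s` with the cutoff determined by `s`. -/
noncomputable def prunedTree (f : Finset U → ℝ) (k : ℕ) (s : List U) : Finset (List U) :=
  recordTree (gainClass f) k (recordCutoff f k s.toFinset) s

/-- The elements of the pruned record tree. -/
noncomputable def prunedElements (f : Finset U → ℝ) (k : ℕ) (s : List U) : List U :=
  recordElements (gainClass f) k (recordCutoff f k s.toFinset) s

theorem exists_best_path (f : Finset U → ℝ) (k : ℕ) (s : List U) :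
    ∃ p ∈ prunedTree f k s, ∀ p' ∈ prunedTree f k s, f p'.toFinset ≤ f p.toFinset :=
  Finset.exists_max_image _ (fun p : List U => f p.toFinset) ⟨[], nil_mem_recordTree s⟩

/-- A path of largest value in the pruned record tree. -/
noncomputable def bestPath (f : Finset U → ℝ) (k : ℕ) (s : List U) : List U :=
  (exists_best_path f k s).choose

theorem bestPath_mem (f : Finset U → ℝ) (k : ℕ) (s : List U) :
    bestPath f k s ∈ prunedTree f k s :=
  (exists_best_path f k s).choose_spec.1

theorem le_bestPath {k : ℕ} {s p : List U} (hp : p ∈ prunedTree f k s) :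
    f p.toFinset ≤ f (bestPath f k s).toFinset :=
  (exists_best_path f k s).choose_spec.2 p hp

/-- The algorithm that stores the elements of the pruned record tree of the stream, and that
recovers this tree from the stored elements in every step. -/
noncomputable def recordAlgorithm (U : Type*) [DecidableEq U] (k : ℕ) : StreamingAlgorithm U where
  step q M e := prunedElements q k (M ++ [e])
  step_subset q M e x hx := by
    have := List.mem_of_mem_filter hx
    simpa [or_comm] using this
  output q M := (bestPath q k M).toFinset
  output_subset q M x hx :=
    List.mem_toFinset.2 (subset_of_mem_recordTree (bestPath_mem q k M) (List.mem_toFinset.1 hx))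

theorem gainClass_visibleOracle {A : Finset U} {p : List U} {e : U} (hp : p.toFinset ⊆ A)
    (he : e ∈ A) : gainClass (visibleOracle f A) p e = gainClass f p e := by
  rw [gainClass, gainClass, gain, gain, visibleOracle, visibleOracle,
    if_pos (Finset.insert_subset he hp), if_pos hp]

theorem recordCutoff_visibleOracle {A S : Finset U} (k : ℕ) (hS : S ⊆ A) :
    recordCutoff (visibleOracle f A) k S = recordCutoff f k S := by
  rw [recordCutoff, recordCutoff,
    Finset.sup_congr rfl fun e he => gainClass_visibleOracle (by simp) (hS he)]

theorem prunedTree_visibleOracle {A : Finset U} (k : ℕ) {s : List U} (hs : s.toFinset ⊆ A) :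
    prunedTree (visibleOracle f A) k s = prunedTree f k s := by
  rw [prunedTree, prunedTree, recordCutoff_visibleOracle k hs]
  refine recordTree_congr s fun p e hp he => gainClass_visibleOracle (fun x hx => ?_)
    (hs (List.mem_toFinset.2 he))
  exact hs (List.mem_toFinset.2 (hp (List.mem_toFinset.1 hx)))

theorem prunedElements_visibleOracle {A : Finset U} (k : ℕ) {s : List U} (hs : s.toFinset ⊆ A) :
    prunedElements (visibleOracle f A) k s = prunedElements f k s := by
  have h := prunedTree_visibleOracle (f := f) k hs
  unfold prunedTree at h
  unfold prunedElements recordElements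
  rw [h]

theorem recordTree_zero (cls : List U → U → WithBot ℤ) (J : WithBot ℤ) (s : List U) :
    recordTree cls 0 J s = {[]} := by
  refine Finset.eq_singleton_iff_unique_mem.2 ⟨nil_mem_recordTree s, fun p hp => ?_⟩
  exact List.eq_nil_of_length_eq_zero (Nat.le_zero.1 (length_le_of_mem_recordTree hp))

theorem recordElements_zero (cls : List U → U → WithBot ℤ) (J : WithBot ℤ) (s : List U) :
    recordElements cls 0 J s = [] := by
  simp [recordElements, recordTree_zero]

theorem exists_max_root {k : ℕ} (hk : 0 < k) {s : List U}
    (h : ⊥ < s.toFinset.sup (gainClass f [])) :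
    ∃ c ∈ s, [c] ∈ prunedTree f k s ∧ gainClass f [] c = s.toFinset.sup (gainClass f []) := by
  have hne : s.toFinset.Nonempty := by
    rw [Finset.nonempty_iff_ne_empty]
    intro h0
    rw [h0, Finset.sup_empty] at h
    exact lt_irrefl _ h
  obtain ⟨o, ho, hoeq⟩ := Finset.exists_mem_eq_sup _ hne (gainClass f [])
  obtain ⟨c, hc, hle⟩ := exists_root_extension (cls := gainClass f) hk
    (J := recordCutoff f k s.toFinset) (List.mem_toFinset.1 ho)
    ((lowerLevel_le _ _).trans_eq hoeq) (hoeq ▸ h)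
  have hcs : c ∈ s := subset_of_mem_recordTree hc (by simp)
  exact ⟨c, hcs, hc, le_antisymm (Finset.le_sup (List.mem_toFinset.2 hcs)) (hoeq ▸ hle)⟩

theorem sup_prunedElements {k : ℕ} (hk : 0 < k) (s : List U) :
    (prunedElements f k s).toFinset.sup (gainClass f []) = s.toFinset.sup (gainClass f []) := by
  refine le_antisymm (Finset.sup_mono fun x hx => ?_) ?_
  · exact List.mem_toFinset.2 (List.mem_of_mem_filter (List.mem_toFinset.1 hx))
  · by_cases h : ⊥ < s.toFinset.sup (gainClass f [])
    · obtain ⟨c, -, hc, heq⟩ := exists_max_root hk h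
      rw [← heq]
      exact Finset.le_sup (List.mem_toFinset.2 (mem_recordElements.2 ⟨_, hc, by simp⟩))
    · rw [not_bot_lt_iff.1 h]
      exact bot_le

theorem recordCutoff_prunedElements {k : ℕ} (hk : 0 < k) (s : List U) :
    recordCutoff f k (prunedElements f k s).toFinset = recordCutoff f k s.toFinset := by
  rw [recordCutoff, recordCutoff, sup_prunedElements hk]

theorem prunedTree_prunedElements (k : ℕ) (s : List U) :
    prunedTree f k (prunedElements f k s) = prunedTree f k s := by
  obtain rfl | hk := Nat.eq_zero_or_pos k
  · rw [prunedTree, prunedTree, recordTree_zero, recordTree_zero]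
  · rw [prunedTree, prunedTree, recordCutoff_prunedElements hk]
    exact recordTree_recordElements le_rfl s

theorem prunedElements_append (k : ℕ) {s : List U} {e : U} (he : e ∉ s) :
    prunedElements f k (prunedElements f k s ++ [e]) = prunedElements f k (s ++ [e]) := by
  obtain rfl | hk := Nat.eq_zero_or_pos k
  · rw [prunedElements, recordElements_zero, prunedElements, recordElements_zero]
  · have h : recordCutoff f k (prunedElements f k s ++ [e]).toFinset =
        recordCutoff f k (s ++ [e]).toFinset := by
      rw [recordCutoff, recordCutoff, List.toFinset_append, List.toFinset_append,
        Finset.sup_union, Finset.sup_union, sup_prunedElements hk]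
    rw [prunedElements, h]
    exact recordElements_append (lowerLevel_mono _ (Finset.sup_mono (by simp))) he

theorem memory_recordAlgorithm (f : Finset U → ℝ) (k : ℕ) {s : List U} (hs : s.Nodup) :
    (recordAlgorithm U k).memory f s = prunedElements f k s := by
  induction s using List.reverseRecOn with
  | nil => rfl
  | append_singleton s e ih =>
    have he : e ∉ s := fun h => List.disjoint_of_nodup_append hs h (by simp)
    have ih := ih (List.Nodup.of_append_left hs)
    rw [StreamingAlgorithm.memory] at ih ⊢
    rw [List.foldl_append, ih, List.foldl_cons, List.foldl_nil, ← prunedElements_append k he]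
    refine prunedElements_visibleOracle k ?_
    simp

theorem exists_solution_eq (f : Finset U → ℝ) (k : ℕ) {s : List U} (hs : s.Nodup) :
    ∃ p ∈ prunedTree f k s, (recordAlgorithm U k).solution f s = p.toFinset ∧
      ∀ p' ∈ prunedTree f k s, f p'.toFinset ≤ f p.toFinset := by
  rw [StreamingAlgorithm.solution, memory_recordAlgorithm f k hs]
  set M := prunedElements f k s with hM
  have htree : prunedTree (visibleOracle f M.toFinset) k M = prunedTree f k s := by
    rw [prunedTree_visibleOracle k subset_rfl, prunedTree_prunedElements]
  have hvis : ∀ p ∈ prunedTree f k s, visibleOracle f M.toFinset p.toFinset = f p.toFinset := by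
    intro p hp
    refine if_pos fun x hx => ?_
    exact List.mem_toFinset.2 (mem_recordElements.2 ⟨p, hp, List.mem_toFinset.1 hx⟩)
  have hmem := bestPath_mem (visibleOracle f M.toFinset) k M
  rw [htree] at hmem
  refine ⟨_, hmem, rfl, fun p' hp' => ?_⟩
  rw [← hvis _ hmem, ← hvis _ hp']
  exact le_bestPath (htree ▸ hp')

theorem length_prunedElements_le {E : Finset U} (hf : IsMonotoneSubmodularOn f E) (k : ℕ)
    {s : List U} (hs : s.Nodup) (hsE : s.toFinset ⊆ E) :
    (prunedElements f k s).length ≤ (10002 * k) ^ k := by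
  obtain rfl | hk := Nat.eq_zero_or_pos k
  · simp [prunedElements, recordElements_zero]
  refine (length_recordElements_le hs).trans ?_
  have hE : ∀ p e, e :: p ∈ prunedTree f k s → e ∈ s ∧ p.toFinset ⊆ E := fun p e h =>
    ⟨subset_of_mem_recordTree h (by simp), fun x hx => hsE (List.mem_toFinset.2
      (subset_of_mem_recordTree h (List.mem_cons_of_mem _ (List.mem_toFinset.1 hx))))⟩
  have hle : ∀ p e, e :: p ∈ prunedTree f k s →
      gainClass f p e ≤ s.toFinset.sup (gainClass f []) := by
    intro p e h
    have hes := List.mem_toFinset.2 (hE p e h).1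
    refine le_trans (gainLevel_mono ?_) (Finset.le_sup (f := gainClass f []) hes)
    exact hf.gain_anti (by simp) (hE p e h).2 (hsE hes)
  obtain ⟨K, hK, hKcard⟩ : ∃ K : Finset (WithBot ℤ), (∀ p e, e :: p ∈ prunedTree f k s →
      gainClass f p e ∈ K) ∧ K.card ≤ 10000 * k + 1 := by
    rcases h : s.toFinset.sup (gainClass f []) with _ | z
    · refine ⟨∅, fun p e hp => ?_, by simp⟩
      have h1 := hle p e hp
      rw [h] at h1
      exact absurd (tail_mem_recordTree hp).2.2 (not_lt.2 h1)
    · refine ⟨(Finset.Icc (z - (10000 * k : ℕ)) z).image WithBot.some, fun p e hp => ?_,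
        Finset.card_image_le.trans (by rw [Int.card_Icc]; omega)⟩
      have h1 := hle p e hp
      obtain ⟨-, h2, h3⟩ := tail_mem_recordTree hp
      rw [recordCutoff, h] at h2
      rw [h] at h1
      rcases hc : gainClass f p e with _ | y
      · rw [hc] at h3
        exact absurd h3 (lt_irrefl _)
      · rw [hc] at h1 h2
        refine Finset.mem_image_of_mem _ (Finset.mem_Icc.2 ⟨?_, ?_⟩)
        · exact WithBot.coe_le_coe.1 h2
        · exact WithBot.coe_le_coe.1 h1
  exact (card_recordTree_le hK).trans (Nat.pow_le_pow_left (by omega) k)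

end Algorithm

section Main

variable {U : Type*} [DecidableEq U] {f : Finset U → ℝ} {n : ℕ} {σ : Fin n ↪ U}
  {G : Finset (Fin n)}

/-- The largest class is the class of a nonnegative number. -/
theorem exists_sup_gainClass {E : Finset U} (hf : IsMonotoneSubmodularOn f E) :
    ∃ m, 0 ≤ m ∧ E.sup (gainClass f []) = gainLevel m := by
  obtain rfl | hE := E.eq_empty_or_nonempty
  · exact ⟨0, le_rfl, by simp [gainLevel]⟩
  · obtain ⟨e, he, hmax⟩ := Finset.exists_max_image E (gain f ∅) hE
    refine ⟨gain f ∅ e, hf.gain_nonneg (by simp) he, ?_⟩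
    exact le_antisymm (Finset.sup_le fun x hx => gainLevel_mono (hmax x hx))
      (Finset.le_sup (f := gainClass f []) he)

theorem le_expect_solution (hf : IsMonotoneSubmodularOn f (Finset.univ.map σ)) {T : Finset U}
    (hT : T ⊆ G.map σ) {k : ℕ} (hTk : T.card ≤ k) :
    0.55 * f T ≤ 𝔼 π : Equiv.Perm {i // i ∈ G},
      f ((recordAlgorithm U k).solution f (arrivalOrder σ G π)) := by
  obtain ⟨m, hm0, hsup⟩ := exists_sup_gainClass hf
  have hTE : T ⊆ Finset.univ.map σ :=
    hT.trans (Finset.map_subset_map.2 (Finset.subset_univ _))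
  have hf0 : 0 ≤ f ∅ := hf.nonneg _ (by simp)
  have hfT : 0 ≤ f T := hf.nonneg _ hTE
  obtain hTm | hTm := le_or_gt (f T) m
  · refine Finset.le_expect Finset.univ_nonempty fun π _ => ?_
    obtain ⟨p, hp, hsol, hbest⟩ := exists_solution_eq f k (nodup_arrivalOrder σ G π)
    rw [hsol]
    obtain rfl | hTne := T.eq_empty_or_nonempty
    · have := hbest [] (nil_mem_recordTree _)
      rw [List.toFinset_nil] at this
      linarith
    have hk : 0 < k := (Finset.card_pos.2 hTne).trans_le hTk
    obtain hm0 | hmpos := hm0.eq_or_lt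
    · have := hf.nonneg p.toFinset fun x hx => by
        rw [← toFinset_arrivalOrder σ G π]
        exact List.mem_toFinset.2 (subset_of_mem_recordTree hp (List.mem_toFinset.1 hx))
      linarith
    have hsup' : (arrivalOrder σ G π).toFinset.sup (gainClass f []) = gainLevel m := by
      rw [toFinset_arrivalOrder, hsup]
    obtain ⟨c, -, hc, hcm⟩ := exists_max_root (f := f) (s := arrivalOrder σ G π) hk
      (by rw [hsup']; exact bot_lt_gainLevel.2 hmpos)
    have h1 := le_of_gainLevel_le hmpos (hsup'.symm.trans hcm.symm).le
    have h2 := hbest _ hc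
    simp only [gain, List.toFinset_nil, List.toFinset_cons] at h1 h2
    linarith
  · set J := recordCutoff f k (Finset.univ.map σ) with hJdef
    set a := m / 1.01 ^ (10000 * k) with ha
    have ha0 : 0 ≤ a := by positivity
    have hJ : ∀ x, ¬ (J ≤ gainLevel x ∧ ⊥ < gainLevel x) → x ≤ a := by
      intro x hx
      rw [hJdef, recordCutoff, hsup] at hx
      exact le_of_not_lowerLevel_le hm0 hx
    have hka : k * a ≤ 0.01 * m := by
      have h := hundred_mul_le_pow k
      rw [ha, mul_div_assoc', div_le_iff₀ (by positivity)]
      nlinarith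
    have hTa : (T.card : ℝ) * a ≤ k * a :=
      mul_le_mul_of_nonneg_right (by exact_mod_cast hTk) ha0
    obtain ⟨F, hF, hFsol⟩ : ∃ F : List U → ℝ,
        (∀ s, ∀ p ∈ recordTree (gainClass f) k J s, f p.toFinset ≤ F s) ∧
        ∀ π, F (arrivalOrder σ G π) =
          f ((recordAlgorithm U k).solution f (arrivalOrder σ G π)) := by
      refine ⟨fun s => (recordTree (gainClass f) k J s).sup' ⟨[], nil_mem_recordTree s⟩
        fun p => f p.toFinset, fun s p hp => Finset.le_sup' (fun p : List U => f p.toFinset) hp,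
        fun π => ?_⟩
      obtain ⟨p, hp, hsol, hbest⟩ := exists_solution_eq f k (nodup_arrivalOrder σ G π)
      rw [prunedTree, toFinset_arrivalOrder] at hp hbest
      rw [hsol]
      exact le_antisymm (Finset.sup'_le _ _ hbest)
        (Finset.le_sup' (fun p : List U => f p.toFinset) hp)
    have key := card_mul_potential_le_sum_agreeing hf hT ha0 hJ hF (Nat.zero_le n) 1
      (p := []) (by simp) (b := T.card) (by simpa using hTk) (by simp)
    have huniv : agreeing G 0 1 = Finset.univ := by
      ext π
      simp [mem_agreeing]
    rw [huniv] at key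
    simp only [List.take_zero, List.toFinset_nil, Finset.sdiff_empty, hFsol] at key
    rw [Finset.expect_eq_sum_div_card, le_div_iff₀' (Nat.cast_pos.2 (Finset.card_pos.2 Finset.univ_nonempty))]
    refine le_trans (mul_le_mul_of_nonneg_left ?_ (Nat.cast_nonneg _)) key
    rw [potential, List.toFinset_nil, Finset.union_empty]
    obtain rfl | hTne := T.eq_empty_or_nonempty
    · simp only [Finset.card_empty, Nat.cast_zero]
      linarith
    · rw [guarantee_self (Finset.card_pos.2 hTne)]
      linarith

end Main

theorem theorem2 :
    ∃ C : ℕ, ∀ (U : Type*) [DecidableEq U], ∃ A : ℕ → StreamingAlgorithm U,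
      ∀ (k n : ℕ) (σ : Fin n ↪ U) (G : Finset (Fin n)) (f : Finset U → ℝ),
        IsMonotoneSubmodularOn f (Finset.univ.map σ) →
        -- for every realization: bounded memory at all times, and a feasible solution
        (∀ π : Equiv.Perm {i // i ∈ G},
          (∀ m ≤ n, ((A k).memory f ((arrivalOrder σ G π).take m)).length ≤ (C * k) ^ k) ∧
          (A k).solution f (arrivalOrder σ G π) ⊆ Finset.univ.map σ ∧
          ((A k).solution f (arrivalOrder σ G π)).card ≤ k) ∧
        -- in expectation over the uniformly random permutation of the good elements
        (0.55 : ℝ) * optValue f k (G.map σ) ≤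
          𝔼 π : Equiv.Perm {i // i ∈ G}, f ((A k).solution f (arrivalOrder σ G π)) := by
  refine ⟨10002, fun U _ => ⟨recordAlgorithm U, fun k n σ G f hf =>
    ⟨fun π => ⟨fun m _ => ?_, ?_⟩, ?_⟩⟩⟩
  · rw [memory_recordAlgorithm f k ((nodup_arrivalOrder σ G π).sublist (List.take_sublist m _))]
    refine length_prunedElements_le hf k
      ((nodup_arrivalOrder σ G π).sublist (List.take_sublist m _)) fun x hx => ?_
    rw [← toFinset_arrivalOrder σ G π]
    exact List.mem_toFinset.2 (List.mem_of_mem_take (List.mem_toFinset.1 hx))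
  · obtain ⟨p, hp, hsol, -⟩ := exists_solution_eq f k (nodup_arrivalOrder σ G π)
    rw [hsol]
    refine ⟨fun x hx => ?_, p.toFinset_card_le.trans (length_le_of_mem_recordTree hp)⟩
    rw [← toFinset_arrivalOrder σ G π]
    exact List.mem_toFinset.2 (subset_of_mem_recordTree hp (List.mem_toFinset.1 hx))
  · obtain ⟨T, hT, heq⟩ := Finset.exists_mem_eq_sup' (s := (G.map σ).powerset.filter
      fun S => S.card ≤ k) ⟨∅, by simp⟩ f
    rw [Finset.mem_filter, Finset.mem_powerset] at hT
    rw [optValue, heq]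
    exact le_expect_solution hf hT.1 hT.2
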